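/- Let $\Bbbk$ be an infinite field and let $A\subset\mathbb{Z}^d\smallsetminus\{0\}$ be a finite set whose real cone $\mathbb{R}_{\ge 0}A$ is strongly convex (contains no line). Write $\mathbb{N}A$ for the monoid generated by $A$, and $\Bbbk[\mathbb{N}A]$ for its semigroup ring, with monomials $t^a$, $a\in\mathbb{N}A$; a monomial ideal is an ideal generated by monomials. A face of $A$ is a subset $F\subseteq A$ such that $\mathbb{R}_{\ge0}F$ is a face of $\mathbb{R}_{\ge0}A$ and $\mathbb{R}_{\ge0}F\cap A=F$ (so $F=A$ is allowed, and $F=\varnothing$ stands for the origin). For a face $F$, let $\mathfrak{p}_F=\langle t^a \mid a\in\mathbb{N}A\smallsetminus\mathbb{N}F\rangle$. A pair of $A$ is $(a,F)$ with $a\in\mathbb{N}A$ and $F$ a face of $A$. A proper pair of a monomial ideal $I$ is a pair $(a,F)$ with $t^b\notin I$ for all $b\in a+\mathbb{N}F$. A standard pair of $I$ is a proper pair $(a,F)$ of $I$ that is maximal among the proper pairs of $I$ for the partial order $(a,F)\prec(b,G)\iff a+\mathbb{N}F\subseteq b+\mathbb{N}G$. Two pairs $(a,F)$ and $(b,G)$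 overlap if $F=G$ and $a-b\in\mathbb{Z}F$; this is an equivalence relation. The pair $(a,F)$ divides $(b,G)$ if $a+c+\mathbb{N}F\subseteq b+\mathbb{N}G$ for some $c\in\mathbb{N}A$; this induces a partial order on overlap classes. An overlap class of standard pairs of $I$ is called maximal if it divides no other overlap class of standard pairs of $I$. An ideal is irreducible if it is proper and is not the intersection of two strictly larger ideals. An irredundant irreducible decomposition of $I$ is a finite set of irreducible ideals (not necessarily monomial) with intersection $I$, none of which contains the intersection of the others. Corollary. Let $F$ be a face of $A$ and let $I$ be a $\mathfrak{p}_F$-primary monomial ideal in $\Bbbk[\mathbb{N}A]$. Then $I$ has an irredundant irreducible decomposition, and the number of components in any irredundant irreducible decomposition of $I$ equals the number of maximal overlap classes of standard pairs of $I$; in particular the latter number is finite. Moreover, $I$ is irreducible if and only if it has exactly one maximal overlap class of standard pairs. -/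

import Mathlib

namespace SemigroupRing

noncomputable section

/-- The affine semigroup `ℕA`: nonnegative integer combinations of the lattice points in `A`. -/
abbrev semigroup {d : ℕ} (A : Finset (Fin d → ℤ)) : AddSubmonoid (Fin d → ℤ) :=
  AddSubmonoid.closure (A : Set (Fin d → ℤ))

/-- The group `ℤA`: integer combinations of the lattice points in `A`. -/
abbrev lattice {d : ℕ} (A : Finset (Fin d → ℤ)) : AddSubgroup (Fin d → ℤ) :=
  AddSubgroup.closure (A : Set (Fin d → ℤ))

/-- A lattice point viewed as a real vector. -/
def toReal {d : ℕ} (a : Fin d → ℤ) : Fin d → ℝ := fun i => (a i : ℝ)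

/-- The cone `ℝ≥0 A` of nonnegative real combinations of the points of `A`. -/
def cone {d : ℕ} (A : Finset (Fin d → ℤ)) : PointedCone ℝ (Fin d → ℝ) :=
  PointedCone.hull ℝ (toReal '' (A : Set (Fin d → ℤ)))

/-- The cone `ℝ≥0 A` is strongly convex: it contains no line. -/
def StronglyConvex {d : ℕ} (A : Finset (Fin d → ℤ)) : Prop :=
  ((cone A : PointedCone ℝ (Fin d → ℝ)) : ConvexCone ℝ (Fin d → ℝ)).Salient

/-- `F ⊆ A` is a face of `A`: `ℝ≥0 F` is a face of `ℝ≥0 A` and `ℝ≥0 F ∩ A = F`.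
The empty set stands for the origin, and `A` is a face of itself. -/
structure IsFace {d : ℕ} (A F : Finset (Fin d → ℤ)) : Prop where
  subset : F ⊆ A
  isFaceOf : (cone F).IsFaceOf (cone A)
  mem_of_mem_cone : ∀ a ∈ A, toReal a ∈ cone F → a ∈ F

/-- The semigroup ring `k[ℕA]`. -/
abbrev MonoidRing (k : Type*) [Field k] {d : ℕ} (A : Finset (Fin d → ℤ)) : Type _ :=
  AddMonoidAlgebra k (semigroup A)

/-- The monomial `t ^ a` of `k[ℕA]`, for `a ∈ ℕA`. -/
def monomial (k : Type*) [Field k] {d : ℕ} {A : Finset (Fin d → ℤ)} (a : semigroup A) :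
    MonoidRing k A :=
  AddMonoidAlgebra.single a 1

/-- A monomial ideal: an ideal generated by monomials. -/
def IsMonomial {k : Type*} [Field k] {d : ℕ} {A : Finset (Fin d → ℤ)}
    (I : Ideal (MonoidRing k A)) : Prop :=
  ∃ S : Set (semigroup A), I = Ideal.span (monomial k '' S)

/-- The monomial ideal `p_F`, generated by the monomials `t ^ a` with `a ∈ ℕA \ ℕF`. -/
def facePrime (k : Type*) [Field k] {d : ℕ} (A F : Finset (Fin d → ℤ)) : Ideal (MonoidRing k A) :=
  Ideal.span (monomial k '' {a : semigroup A | (a : Fin d → ℤ) ∉ semigroup F})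

/-- The set of exponents of the standard monomials of `I`, i.e. of the monomials of `k[ℕA]`
that do not lie in `I`. -/
def stdMono {k : Type*} [Field k] {d : ℕ} {A : Finset (Fin d → ℤ)}
    (I : Ideal (MonoidRing k A)) : Set (Fin d → ℤ) :=
  {a | ∃ h : a ∈ semigroup A, monomial k ⟨a, h⟩ ∉ I}

/-- A pair `(a, F)` of `A`: an element `a` of `ℕA` and a face `F` of `A`. -/
structure FacePair {d : ℕ} (A : Finset (Fin d → ℤ)) where
  base : Fin d → ℤ
  base_mem : base ∈ semigroup A
  face : Finset (Fin d → ℤ)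
  isFace : IsFace A face

namespace FacePair

variable {d : ℕ} {A : Finset (Fin d → ℤ)}

/-- The set `a + ℕF` of a pair `(a, F)`. -/
def region (P : FacePair A) : Set (Fin d → ℤ) :=
  {x | ∃ c ∈ semigroup P.face, x = P.base + c}

/-- `(a, F) ≺ (b, G)`: the set `a + ℕF` is contained in `b + ℕG`. -/
def Prec (P Q : FacePair A) : Prop := P.region ⊆ Q.region

/-- `(a, F)` and `(b, G)` overlap: `F = G` and `a - b ∈ ℤF`. -/
def Overlap (P Q : FacePair A) : Prop :=
  P.face = Q.face ∧ P.base - Q.base ∈ lattice P.face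

/-- `(a, F)` divides `(b, G)`: there is `c ∈ ℕA` such that `a + c + ℕF ⊆ b + ℕG`. -/
def Divides (P Q : FacePair A) : Prop :=
  ∃ c ∈ semigroup A, ∀ f ∈ semigroup P.face, P.base + c + f ∈ Q.region

/-- `(a, F)` is a proper pair of `I`: all exponents in `a + ℕF` are standard. -/
def IsProper {k : Type*} [Field k] (I : Ideal (MonoidRing k A)) (P : FacePair A) : Prop :=
  P.region ⊆ stdMono I

/-- A standard pair of `I`: a proper pair which is maximal with respect to `≺`. -/
def IsStandard {k : Type*} [Field k] (I : Ideal (MonoidRing k A)) (P : FacePair A) : Prop :=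
  P.IsProper I ∧ ∀ Q : FacePair A, Q.IsProper I → P.Prec Q → Q = P

theorem overlap_equivalence : Equivalence (Overlap (A := A)) where
  refl P := ⟨rfl, by simp⟩
  symm := by
    rintro P Q ⟨h, h'⟩
    refine ⟨h.symm, ?_⟩
    rw [← h, ← neg_sub]
    exact neg_mem h'
  trans := by
    rintro P Q R ⟨h, h'⟩ ⟨g, g'⟩
    refine ⟨h.trans g, ?_⟩
    rw [← h] at g'
    have := add_mem h' g'
    rwa [sub_add_sub_cancel] at this

end FacePair

/-- The standard pairs of `I`. -/
abbrev StdPairs {k : Type*} [Field k] {d : ℕ} {A : Finset (Fin d → ℤ)}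
    (I : Ideal (MonoidRing k A)) : Type _ :=
  {P : FacePair A // P.IsStandard I}

/-- Overlapping, as an equivalence relation on the standard pairs of `I`. -/
def overlapSetoid {k : Type*} [Field k] {d : ℕ} {A : Finset (Fin d → ℤ)}
    (I : Ideal (MonoidRing k A)) : Setoid (StdPairs I) where
  r P Q := P.1.Overlap Q.1
  iseqv := FacePair.overlap_equivalence.comap Subtype.val

/-- The overlap classes of standard pairs of `I`. -/
abbrev OverlapClass {k : Type*} [Field k] {d : ℕ} {A : Finset (Fin d → ℤ)}
    (I : Ideal (MonoidRing k A)) : Type _ :=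
  Quotient (overlapSetoid I)

/-- Divisibility of overlap classes: it is induced by divisibility of the pairs in them. -/
def OverlapClass.Divides {k : Type*} [Field k] {d : ℕ} {A : Finset (Fin d → ℤ)}
    {I : Ideal (MonoidRing k A)} (C D : OverlapClass I) : Prop :=
  ∃ P Q : StdPairs I, Quotient.mk (overlapSetoid I) P = C ∧
    Quotient.mk (overlapSetoid I) Q = D ∧ P.1.Divides Q.1

/-- The set of overlap classes of standard pairs of `I` that are maximal with respect to
divisibility among all overlap classes of standard pairs of `I`. -/
def maximalClasses {k : Type*} [Field k] {d : ℕ} {A : Finset (Fin d → ℤ)}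
    (I : Ideal (MonoidRing k A)) : Set (OverlapClass I) :=
  {C | ∀ D : OverlapClass I, C.Divides D → D = C}

open scoped Classical in
/-- The finite set `t` of ideals is an irredundant irreducible decomposition of `I`: its members
are irreducible (proper, and not the intersection of two strictly larger ideals), their
intersection is `I`, and none of them contains the intersection of the others. -/
structure IsIrredundantIrreducibleDecomposition {R : Type*} [CommRing R] (I : Ideal R)
    (t : Finset (Ideal R)) : Prop where
  irreducible : ∀ J ∈ t, InfIrred J
  inf_eq : t.inf id = I
  irredundant : ∀ J ∈ t, ¬ (t.erase J).inf id ≤ J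

end

end SemigroupRing

/-! Fix `I` primary to `p_F`. A monomial `t^f` with `f ∈ ℕF` is a nonzerodivisor modulo `I`, so all
standard pairs have face `F`, and their overlap classes are the cosets of `ℤF` that contain standard
exponents. A class is maximal exactly when its exponents `a` are socle exponents: `a + q` is
standard only for `q ∈ ℕF` (`OverlapClass.mem_maximalClasses_iff`).

Attach to `a` the ideal `cosetIdeal`, whose standard exponents are those that can be translated into
`a + ℤF`. It is irreducible when it contains a power of `p_F`: a strictly larger ideal contains `t^a
* g` with `0 ≠ g ∈ k[ℕF]`, and `k[ℕA]` is a domain (`infIrred_cosetIdeal`). Since a power of `p_F`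
lies in `I`, each standard exponent can be translated to a socle exponent, so `I` is the
intersection of the coset ideals of its maximal classes. This decomposition is irredundant
(`exists_decomposition_card_eq`), and the Kurosh–Ore theorem carries its cardinality over to all
others, monomial or not. -/

/-! ### The Kurosh–Ore exchange argument in modular lattices. -/

section KuroshOre

variable {α : Type*} [Lattice α] [IsModularLattice α]

/-- In a modular lattice, if `p` is irreducible then `p ⊓ b` is irreducible in `[p ⊓ b, b]`. -/
theorem InfIrred.eq_or_eq_of_inf_eq {p b x y : α} (hp : InfIrred p) (hxb : x ≤ b) (hyb : y ≤ b)
    (hx : p ⊓ b ≤ x) (hy : p ⊓ b ≤ y) (h : x ⊓ y = p ⊓ b) : x = p ⊓ b ∨ y = p ⊓ b := by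
  -- Joining with `p` moves the problem from `[p ⊓ b, b]` to `[p, p ⊔ b]`, where irreducibility of
  -- `p` applies.
  have key : (p ⊔ x) ⊓ (p ⊔ y) = p := by
    have hz : ∀ z, z ≤ b → p ⊓ b ≤ z → (p ⊔ z) ⊓ b = z := fun z hzb hz => by
      rw [sup_comm, sup_inf_assoc_of_le p hzb, sup_eq_left.2 hz]
    have h1 : b ⊓ ((p ⊔ x) ⊓ (p ⊔ y)) = p ⊓ b := by
      rw [inf_comm, inf_inf_distrib_right, hz x hxb hx, hz y hyb hy, h]
    calc (p ⊔ x) ⊓ (p ⊔ y) = (p ⊔ b) ⊓ ((p ⊔ x) ⊓ (p ⊔ y)) := by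
          rw [eq_comm, inf_eq_right]
          exact inf_le_left.trans (sup_le_sup_left hxb p)
      _ = p := by
          rw [sup_inf_assoc_of_le b (le_inf le_sup_left le_sup_left), h1, sup_eq_left]
          exact inf_le_left
  rcases hp.2 key with h' | h'
  · exact Or.inl (le_antisymm (le_inf (h' ▸ le_sup_right) hxb) hx)
  · exact Or.inr (le_antisymm (le_inf (h' ▸ le_sup_right) hyb) hy)

variable [OrderTop α]

/-- Each `b ⊓ q` lies in `[p ⊓ b, b]`, where `p ⊓ b` is irreducible, so members of `t` can be split
off one at a time. -/
theorem InfIrred.exists_inf_eq_of_finset_inf {p b : α} (hp : InfIrred p) (t : Finset α)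
    (ht : ∀ q ∈ t, p ⊓ b ≤ q) (h : b ⊓ t.inf id = p ⊓ b) :
    b = p ⊓ b ∨ ∃ q ∈ t, b ⊓ q = p ⊓ b := by
  classical
  induction t using Finset.induction_on with
  | empty => left; simpa using h
  | insert q t _ ih =>
    have hle : p ⊓ b ≤ t.inf id :=
      Finset.le_inf fun r hr => ht r (Finset.mem_insert_of_mem hr)
    have hq := ht q (Finset.mem_insert_self q t)
    rw [Finset.inf_insert, id, ← inf_assoc] at h
    rcases hp.eq_or_eq_of_inf_eq (x := b ⊓ q) (y := b ⊓ t.inf id) inf_le_left inf_le_left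
      (le_inf inf_le_right hq) (le_inf inf_le_right hle)
      (by rw [← h, ← inf_assoc, inf_right_comm b q b, inf_idem]) with h1 | h1
    · exact Or.inr ⟨q, Finset.mem_insert_self q t, h1⟩
    · rcases ih (fun r hr => ht r (Finset.mem_insert_of_mem hr)) h1 with h2 | ⟨r, hr, h2⟩
      · exact Or.inl h2
      · exact Or.inr ⟨r, Finset.mem_insert_of_mem hr, h2⟩

open scoped Classical in
-- Exchange: each `p ∈ s` is dropped or replaced by a member of `t` without changing the infimum;
-- `v` collects the replacements already made.
theorem exists_subset_inf_eq_of_infIrred (t : Finset α) (s : Finset α) (hs : ∀ p ∈ s, InfIrred p)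
    (v : Finset α) (hv : v ⊆ t) (h : (s ∪ v).inf id = t.inf id) :
    ∃ t' ⊆ t, t'.inf id = t.inf id ∧ t'.card ≤ s.card + v.card := by
  induction s using Finset.induction_on generalizing v with
  | empty => exact ⟨v, hv, by simpa using h, by simp⟩
  | insert p s hps ih =>
    have hs' : ∀ q ∈ s, InfIrred q := fun q hq => hs q (Finset.mem_insert_of_mem hq)
    rw [Finset.insert_union, Finset.inf_insert, id] at h
    have hle : t.inf id ≤ (s ∪ v).inf id := h ▸ inf_le_right
    rw [Finset.card_insert_of_notMem hps]
    rcases (hs p (Finset.mem_insert_self p s)).exists_inf_eq_of_finset_inf (b := (s ∪ v).inf id) t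
      (fun q hq => h ▸ Finset.inf_le hq) (by rw [h]; exact inf_eq_right.2 hle) with h1 | ⟨q, hq, h1⟩
    · obtain ⟨t', h2, h3, h4⟩ := ih hs' v hv (h1.trans h)
      exact ⟨t', h2, h3, by omega⟩
    · obtain ⟨t', h2, h3, h4⟩ := ih hs' (insert q v) (Finset.insert_subset hq hv)
        (by rw [Finset.union_insert, Finset.inf_insert, id, inf_comm, h1, h])
      exact ⟨t', h2, h3, by have := Finset.card_insert_le q v; omega⟩

open scoped Classical in
/-- One half of the Kurosh–Ore theorem. -/
theorem card_le_card_of_infIrred {s t : Finset α} (hs : ∀ p ∈ s, InfIrred p)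
    (hst : s.inf id = t.inf id) (ht : ∀ q ∈ t, ¬ (t.erase q).inf id ≤ q) : t.card ≤ s.card := by
  obtain ⟨t', h1, h2, h3⟩ := exists_subset_inf_eq_of_infIrred t s hs ∅ (by simp) (by simpa using hst)
  have : t' = t := by
    refine Finset.Subset.antisymm h1 fun q hq => ?_
    by_contra hqt
    refine ht q hq ?_
    calc (t.erase q).inf id ≤ t'.inf id :=
          Finset.inf_mono fun r hr => Finset.mem_erase.2 ⟨fun h => hqt (h ▸ hr), h1 hr⟩
      _ = t.inf id := h2
      _ ≤ q := Finset.inf_le hq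
  subst this
  simpa using h3

end KuroshOre

/-! ### Irreducible decompositions and socles in commutative rings. -/

namespace SemigroupRing

/-- The Kurosh–Ore theorem for ideals. -/
theorem IsIrredundantIrreducibleDecomposition.card_eq {R : Type*} [CommRing R] {I : Ideal R}
    {s t : Finset (Ideal R)} (hs : IsIrredundantIrreducibleDecomposition I s)
    (ht : IsIrredundantIrreducibleDecomposition I t) : s.card = t.card :=
  le_antisymm
    (card_le_card_of_infIrred ht.irreducible (ht.inf_eq.trans hs.inf_eq.symm) hs.irredundant)
    (card_le_card_of_infIrred hs.irreducible (hs.inf_eq.trans ht.inf_eq.symm) ht.irredundant)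

theorem isIrredundantIrreducibleDecomposition_singleton {R : Type*} [CommRing R] {I : Ideal R}
    (hI : InfIrred I) : IsIrredundantIrreducibleDecomposition I {I} where
  irreducible := by simpa using hI
  inf_eq := by simp
  irredundant := by
    have : I ≠ ⊤ := fun h => hI.1 (h ▸ isMax_top)
    simpa using this

/-- For the least `n` with `x * p ^ n ⊆ J`, any element of `x * p ^ (n - 1)` outside `J` is killed
by `p` modulo `J`. -/
theorem exists_mul_mem_of_pow_le {R : Type*} [CommRing R] {J p : Ideal R} {n : ℕ} (hn : p ^ n ≤ J)
    {x : R} (hx : x ∉ J) : ∃ y, x ∣ y ∧ y ∉ J ∧ ∀ z ∈ p, y * z ∈ J := by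
  classical
  have hex : ∃ n, Ideal.span {x} * p ^ n ≤ J := ⟨n, le_trans Ideal.mul_le_right hn⟩
  obtain ⟨m, hm⟩ : ∃ m, Nat.find hex = m + 1 := by
    refine Nat.exists_eq_succ_of_ne_zero fun h0 => hx ?_
    have := Nat.find_spec hex
    rw [h0, pow_zero, mul_one] at this
    exact this (Ideal.mem_span_singleton_self x)
  have h1 := Nat.find_spec hex
  have h2 := Nat.find_min hex (m := m) (by omega)
  rw [hm, pow_succ, ← mul_assoc] at h1
  obtain ⟨y, hy, hyJ⟩ := SetLike.not_le_iff_exists.1 h2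
  exact ⟨y, Ideal.mem_span_singleton.1 (Ideal.mul_le_left hy), hyJ,
    fun z hz => h1 (Ideal.mul_mem_mul hy hz)⟩

/-! ### Faces, their monoids and their lattices. -/

section Faces

variable {d : ℕ} {A F G : Finset (Fin d → ℤ)} {x y : Fin d → ℤ}

theorem toReal_zero : toReal (0 : Fin d → ℤ) = 0 := by ext; simp [toReal]

theorem toReal_add (x y : Fin d → ℤ) : toReal (x + y) = toReal x + toReal y := by
  ext; simp [toReal]

theorem toReal_mem_cone (hx : x ∈ semigroup A) : toReal x ∈ cone A := by
  induction hx using AddSubmonoid.closure_induction with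
  | mem x hx => exact Submodule.subset_span ⟨x, hx, rfl⟩
  | zero => rw [toReal_zero]; exact zero_mem _
  | add x y _ _ hx hy => rw [toReal_add]; exact add_mem hx hy

theorem IsFace.semigroup_le (hF : IsFace A F) : semigroup F ≤ semigroup A :=
  AddSubmonoid.closure_mono (by exact_mod_cast hF.subset)

/-- The face property of the cone passes membership to summands, down to the generators, where `ℝ≥0
F ∩ A = F` applies. -/
theorem IsFace.mem_semigroup_of_mem_cone (hF : IsFace A F) (hx : x ∈ semigroup A)
    (h : toReal x ∈ cone F) : x ∈ semigroup F := by
  induction hx using AddSubmonoid.closure_induction with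
  | mem x hx => exact AddSubmonoid.subset_closure (hF.mem_of_mem_cone x hx h)
  | zero => exact zero_mem _
  | add x y hx hy ihx ihy =>
    rw [toReal_add, hF.isFaceOf.add_mem_iff_mem (toReal_mem_cone hx) (toReal_mem_cone hy)] at h
    exact add_mem (ihx h.1) (ihy h.2)

theorem IsFace.mem_of_add_mem (hF : IsFace A F) (hx : x ∈ semigroup A) (hy : y ∈ semigroup A)
    (h : x + y ∈ semigroup F) : x ∈ semigroup F := by
  have := toReal_mem_cone h
  rw [toReal_add, hF.isFaceOf.add_mem_iff_mem (toReal_mem_cone hx) (toReal_mem_cone hy)] at this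
  exact hF.mem_semigroup_of_mem_cone hx this.1

theorem exists_sub_eq_of_mem_lattice (hx : x ∈ lattice F) :
    ∃ f ∈ semigroup F, ∃ g ∈ semigroup F, x = f - g := by
  induction hx using AddSubgroup.closure_induction with
  | mem x hx => exact ⟨x, AddSubmonoid.subset_closure hx, 0, zero_mem _, by simp⟩
  | zero => exact ⟨0, zero_mem _, 0, zero_mem _, by simp⟩
  | add x y _ _ hx hy =>
    obtain ⟨f, hf, g, hg, rfl⟩ := hx
    obtain ⟨f', hf', g', hg', rfl⟩ := hy
    exact ⟨_, add_mem hf hf', _, add_mem hg hg', by abel⟩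
  | neg x _ hx =>
    obtain ⟨f, hf, g, hg, rfl⟩ := hx
    exact ⟨g, hg, f, hf, by abel⟩

theorem semigroup_le_lattice (hx : x ∈ semigroup F) : x ∈ lattice F :=
  (AddSubmonoid.closure_le (S := (lattice F).toAddSubmonoid)).2 AddSubgroup.subset_closure hx

/-- If `x = f - g`, then `x + g = f ∈ ℕF`, and a face contains the summands of its elements. -/
theorem IsFace.mem_semigroup_of_mem_lattice (hF : IsFace A F) (hx : x ∈ semigroup A)
    (h : x ∈ lattice F) : x ∈ semigroup F := by
  obtain ⟨f, hf, g, hg, rfl⟩ := exists_sub_eq_of_mem_lattice h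
  exact hF.mem_of_add_mem hx (hF.semigroup_le hg) (by simpa using hf)

theorem IsFace.subset_of_semigroup_le (hF : IsFace A F) (hG : IsFace A G)
    (h : semigroup G ≤ semigroup F) : G ⊆ F := fun g hg =>
  hF.mem_of_mem_cone g (hG.subset hg) (toReal_mem_cone (h (AddSubmonoid.subset_closure hg)))

theorem StronglyConvex.eq_zero_of_add_eq_zero (hA : StronglyConvex A) (hx : x ∈ semigroup A)
    (hy : y ∈ semigroup A) (h : x + y = 0) : x = 0 := by
  by_contra hx0
  refine hA (toReal x) (toReal_mem_cone hx) (fun h0 => hx0 ?_) ?_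
  · ext i
    simpa [toReal] using congrFun h0 i
  · have : -toReal x = toReal y := by
      rw [neg_eq_iff_add_eq_zero, ← toReal_add, h, toReal_zero]
    rw [this]
    exact toReal_mem_cone hy

end Faces

end SemigroupRing

namespace SemigroupRing

/-! ### Monomial ideals and socle exponents. -/

section Ring

variable {k : Type*} [Field k] {d : ℕ} {A F : Finset (Fin d → ℤ)} {I J : Ideal (MonoidRing k A)}

/-- Inherited from `ℤ^d`; it makes `k[ℕA]` a domain. -/
instance : UniqueSums (semigroup A) :=
  UniqueSums.of_injective_addHom (semigroup A).subtype.toAddHom Subtype.val_injective inferInstance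

instance : IsNoetherianRing (MonoidRing k A) :=
  Algebra.FiniteType.isNoetherianRing k _

theorem monomial_add (a b : semigroup A) : monomial k (a + b) = monomial k a * monomial k b := by
  simp [monomial, AddMonoidAlgebra.single_mul_single]

theorem support_monomial (a : semigroup A) : (monomial k a).coeff.support = {a} := by
  simp [monomial, Finsupp.support_single]

theorem mem_span_monomial {S : Set (semigroup A)} {x : MonoidRing k A} :
    x ∈ Ideal.span (monomial k '' S) ↔
      ∀ b ∈ x.coeff.support, ∃ s ∈ S, ∃ c, b = c + s :=
  AddMonoidAlgebra.mem_ideal_span_of'_image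

theorem monomial_mem_span {S : Set (semigroup A)} {b : semigroup A} :
    monomial k b ∈ Ideal.span (monomial k '' S) ↔ ∃ s ∈ S, ∃ c, b = c + s := by
  rw [mem_span_monomial, support_monomial]
  simp

theorem IsMonomial.mem_iff (h : IsMonomial I) {x : MonoidRing k A} :
    x ∈ I ↔ ∀ b ∈ x.coeff.support, monomial k b ∈ I := by
  obtain ⟨S, rfl⟩ := h
  rw [mem_span_monomial]
  exact forall₂_congr fun b _ => monomial_mem_span.symm

theorem IsMonomial.le_of_forall (h : IsMonomial I)
    (hIJ : ∀ b, monomial k b ∈ I → monomial k b ∈ J) : I ≤ J := by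
  obtain ⟨S, rfl⟩ := h
  rw [Ideal.span_le]
  rintro _ ⟨s, hs, rfl⟩
  exact hIJ s (Ideal.subset_span ⟨s, hs, rfl⟩)

theorem monomial_notMem_of_add {a b : semigroup A} (h : monomial k (a + b) ∉ I) :
    monomial k a ∉ I := fun ha => h (monomial_add (k := k) a b ▸ Ideal.mul_mem_right _ _ ha)

theorem IsFace.monomial_mem_facePrime (hF : IsFace A F) {a : semigroup A} :
    monomial k a ∈ facePrime k A F ↔ (a : Fin d → ℤ) ∉ semigroup F := by
  rw [facePrime, monomial_mem_span]
  constructor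
  · rintro ⟨s, hs, c, rfl⟩ h
    rw [add_comm] at h
    exact hs (hF.mem_of_add_mem s.2 c.2 h)
  · intro h
    exact ⟨a, h, 0, by simp⟩

/-- `t^f` lies outside the radical `p_F`, hence is a nonzerodivisor modulo the primary ideal `I`. -/
theorem IsFace.monomial_add_notMem (hF : IsFace A F) (hprim : I.IsPrimary)
    (hrad : I.radical = facePrime k A F) {a f : semigroup A} (ha : monomial k a ∉ I)
    (hf : (f : Fin d → ℤ) ∈ semigroup F) : monomial k (a + f) ∉ I := by
  intro h
  rw [monomial_add] at h
  rcases (Ideal.isPrimary_iff.1 hprim).2 h with h | h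
  · exact ha h
  · rw [hrad, hF.monomial_mem_facePrime] at h
    exact h hf

/-- A standard exponent `a` of `I` that only elements of `ℕF` translate to standard exponents. -/
def IsSocleExponent (F : Finset (Fin d → ℤ)) (I : Ideal (MonoidRing k A)) (a : semigroup A) :
    Prop :=
  monomial k a ∉ I ∧ ∀ q : semigroup A, monomial k (a + q) ∉ I → (q : Fin d → ℤ) ∈ semigroup F

/-- Take `y` with `y * p_F ⊆ I`. For `q ∉ ℕF` the product `y * t^q` lies in the monomial ideal `I`,
hence so does each of its monomials `t^(b + q)`. -/
theorem IsMonomial.exists_dvd_isSocleExponent (hI : IsMonomial I) {n : ℕ}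
    (hn : facePrime k A F ^ n ≤ I) {x : MonoidRing k A} (hx : x ∉ I) :
    ∃ y, x ∣ y ∧ y ∉ I ∧ ∀ b ∈ y.coeff.support, monomial k b ∉ I → IsSocleExponent F I b := by
  obtain ⟨y, hxy, hy, hyp⟩ := exists_mul_mem_of_pow_le hn hx
  refine ⟨y, hxy, hy, fun b hb hbI => ⟨hbI, fun q hq => ?_⟩⟩
  by_contra hqF
  refine hq (hI.mem_iff.1 (hyp (monomial k q) (Ideal.subset_span ⟨q, hqF, rfl⟩)) _ ?_)
  rw [Finsupp.mem_support_iff] at hb ⊢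
  rwa [monomial, AddMonoidAlgebra.coeff_mul_single_add, mul_one]

theorem IsMonomial.exists_add_isSocleExponent (hI : IsMonomial I) {n : ℕ}
    (hn : facePrime k A F ^ n ≤ I) {b : semigroup A} (hb : monomial k b ∉ I) :
    ∃ q, IsSocleExponent F I (b + q) := by
  obtain ⟨y, hby, hy, h⟩ := hI.exists_dvd_isSocleExponent hn hb
  rw [hI.mem_iff] at hy
  push Not at hy
  obtain ⟨c, hc, hcI⟩ := hy
  have hys : y ∈ Ideal.span (monomial k '' {b}) := by
    rwa [Set.image_singleton, Ideal.mem_span_singleton]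
  obtain ⟨_, rfl, q, rfl⟩ := mem_span_monomial.1 hys c hc
  refine ⟨q, ?_⟩
  rw [add_comm]
  exact h _ hc hcI

/-! ### Coset ideals and their irreducibility. -/

/-- The monomial ideal whose standard exponents are the elements of `(a + ℤF - ℕA) ∩ ℕA`. -/
noncomputable def cosetIdeal (k : Type*) [Field k] (F : Finset (Fin d → ℤ)) (a : semigroup A) :
    Ideal (MonoidRing k A) :=
  Ideal.span (monomial k ''
    {b : semigroup A | ∀ q : semigroup A, ((b + q : semigroup A) : Fin d → ℤ) - a ∉ lattice F})

theorem isMonomial_cosetIdeal (a : semigroup A) : IsMonomial (cosetIdeal k F a) := ⟨_, rfl⟩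

theorem monomial_mem_cosetIdeal {a b : semigroup A} : monomial k b ∈ cosetIdeal k F a ↔
    ∀ q : semigroup A, ((b + q : semigroup A) : Fin d → ℤ) - a ∉ lattice F := by
  rw [cosetIdeal, monomial_mem_span]
  constructor
  · rintro ⟨s, hs, c, rfl⟩ q
    have := hs (c + q)
    rwa [← add_assoc, add_comm s c] at this
  · intro h
    exact ⟨b, h, 0, by simp⟩

theorem monomial_notMem_cosetIdeal {a b : semigroup A}
    (h : (b : Fin d → ℤ) - a ∈ lattice F) : monomial k b ∉ cosetIdeal k F a := by
  rw [monomial_mem_cosetIdeal]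
  push Not
  exact ⟨0, by simpa using h⟩

/-- If `t^b ∈ I` and `b + q ∈ a + ℤF`, then `b + q + g = a + f` with `f, g ∈ ℕF`, which forces `t^(a
+ f) ∈ I`. -/
theorem le_cosetIdeal (hF : IsFace A F) (hmon : IsMonomial I) (hprim : I.IsPrimary)
    (hrad : I.radical = facePrime k A F) {a : semigroup A} (ha : monomial k a ∉ I) :
    I ≤ cosetIdeal k F a := by
  refine hmon.le_of_forall fun b hb => ?_
  rw [monomial_mem_cosetIdeal]
  intro q hq
  obtain ⟨f, hf, g, hg, h⟩ := exists_sub_eq_of_mem_lattice hq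
  have h1 : b + q + ⟨g, hF.semigroup_le hg⟩ = a + ⟨f, hF.semigroup_le hf⟩ := by
    ext1
    push_cast at h ⊢
    rw [sub_eq_sub_iff_add_eq_add] at h
    rw [h, add_comm]
  refine hF.monomial_add_notMem hprim hrad ha (f := ⟨f, hF.semigroup_le hf⟩) hf ?_
  rw [← h1, monomial_add, monomial_add]
  exact Ideal.mul_mem_right _ _ (Ideal.mul_mem_right _ _ hb)

/-- The socle sits in one coset: some `b + q` lies in `a + ℤF`, so it is standard and `q ∈ ℕF`. -/
theorem IsSocleExponent.sub_mem_lattice {a b : semigroup A}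
    (hb : IsSocleExponent F (cosetIdeal k F a) b) : (b : Fin d → ℤ) - a ∈ lattice F := by
  have h1 := hb.1
  rw [monomial_mem_cosetIdeal] at h1
  push Not at h1
  obtain ⟨q, hq⟩ := h1
  have h2 := semigroup_le_lattice (hb.2 q (monomial_notMem_cosetIdeal hq))
  have := sub_mem hq h2
  push_cast at this
  convert this using 1
  abel

/-- A common denominator: one `f ∈ ℕF` moves finitely many points of `a + ℤF` into `a + ℕA`. -/
theorem exists_add_eq_add_of_forall_sub_mem (hF : IsFace A F) (a : semigroup A)
    (s : Finset (semigroup A)) (hs : ∀ b ∈ s, (b : Fin d → ℤ) - a ∈ lattice F) :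
    ∃ f : semigroup A, (f : Fin d → ℤ) ∈ semigroup F ∧
      ∀ b ∈ s, ∃ c : semigroup A, b + f = c + a := by
  classical
  induction s using Finset.induction_on with
  | empty => exact ⟨0, zero_mem _, by simp⟩
  | insert b s _ ih =>
    obtain ⟨f, hf, h⟩ := ih fun c hc => hs c (Finset.mem_insert_of_mem hc)
    obtain ⟨g, hg, g', hg', hb⟩ := exists_sub_eq_of_mem_lattice (hs b (Finset.mem_insert_self b s))
    refine ⟨f + ⟨g', hF.semigroup_le hg'⟩, add_mem hf hg', fun c hc => ?_⟩
    rcases Finset.mem_insert.1 hc with rfl | hc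
    · refine ⟨f + ⟨g, hF.semigroup_le hg⟩, ?_⟩
      ext1
      push_cast
      rw [sub_eq_sub_iff_add_eq_add] at hb
      rw [add_left_comm, hb, add_assoc]
    · obtain ⟨e, he⟩ := h c hc
      exact ⟨e + ⟨g', hF.semigroup_le hg'⟩, by rw [← add_assoc, he, add_right_comm]⟩

/-- An ideal strictly above `cosetIdeal k F a` contains some `t ^ a * g` with `0 ≠ g ∈ k[ℕF]`. -/
theorem exists_monomial_mul_mem_of_cosetIdeal_lt (hF : IsFace A F) {a : semigroup A} {n : ℕ}
    (hn : facePrime k A F ^ n ≤ cosetIdeal k F a) {K : Ideal (MonoidRing k A)}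
    (hK : cosetIdeal k F a < K) :
    ∃ g : MonoidRing k A, g ≠ 0 ∧ (∀ b ∈ g.coeff.support, (b : Fin d → ℤ) ∈ semigroup F) ∧
      monomial k a * g ∈ K := by
  classical
  obtain ⟨x, hxK, hxJ⟩ := SetLike.exists_of_lt hK
  obtain ⟨y, hxy, hyJ, hy⟩ := (isMonomial_cosetIdeal a).exists_dvd_isSocleExponent hn hxJ
  have hyK : y ∈ K := Ideal.mem_of_dvd _ hxy hxK
  set J := cosetIdeal k F a with hJ
  -- Discarding the terms of `y` that lie in `J` leaves a nonzero element of `K` supported on socle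
  -- exponents, all in `a + ℤF`.
  obtain ⟨z, hzK, hz0, hz⟩ : ∃ z ∈ K, z ≠ 0 ∧
      ∀ b ∈ z.coeff.support, (b : Fin d → ℤ) - a ∈ lattice F := by
    have hsupp : ∀ (p : semigroup A → Prop) [DecidablePred p], ∀ b ∈ (y.coeff.filter p).support,
        b ∈ y.coeff.support ∧ p b := fun p _ b hb => by
      rwa [Finsupp.support_filter, Finset.mem_filter] at hb
    set z : MonoidRing k A := .ofCoeff (y.coeff.filter fun b => monomial k b ∉ J) with hz
    set w : MonoidRing k A := .ofCoeff (y.coeff.filter fun b => ¬ monomial k b ∉ J) with hw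
    have hyzw : y = z + w := by
      ext b
      simp [hz, hw, Finsupp.filter_apply]
      split_ifs <;> simp
    have hwJ : w ∈ J := by
      rw [(isMonomial_cosetIdeal a).mem_iff]
      intro b hb
      simpa using (hsupp _ b hb).2
    refine ⟨z, ?_, ?_, fun b hb => ?_⟩
    · rw [← sub_eq_iff_eq_add.2 hyzw]
      exact sub_mem hyK (hK.le hwJ)
    · rintro h0
      rw [h0, zero_add] at hyzw
      exact hyJ (hyzw ▸ hwJ)
    · have hb' := hsupp _ b hb
      exact (hy b hb'.1 hb'.2).sub_mem_lattice
  obtain ⟨f, hf, hfs⟩ := exists_add_eq_add_of_forall_sub_mem hF a z.coeff.support hz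
  have hsupp : ∀ c ∈ (z * monomial k f).coeff.support, ∃ b ∈ z.coeff.support, c = b + f := by
    intro c hc
    rw [monomial, AddMonoidAlgebra.support_coeff_mul_single _ _ (by simp)] at hc
    obtain ⟨b, hb, rfl⟩ := Finset.mem_map.1 hc
    exact ⟨b, hb, rfl⟩
  have hmem : z * monomial k f ∈ Ideal.span (monomial k '' {a}) := by
    rw [mem_span_monomial]
    intro c hc
    obtain ⟨b, hb, rfl⟩ := hsupp c hc
    obtain ⟨e, he⟩ := hfs b hb
    exact ⟨a, rfl, e, he⟩
  rw [Set.image_singleton, Ideal.mem_span_singleton] at hmem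
  obtain ⟨g, hg⟩ := hmem
  have hf0 : monomial k f ≠ 0 := by simp [monomial]
  refine ⟨g, ?_, fun b hb => ?_, hg ▸ Ideal.mul_mem_right _ _ hzK⟩
  · rintro rfl
    rw [mul_zero] at hg
    exact (mul_ne_zero hz0 hf0) hg
  · have hab : a + b ∈ (z * monomial k f).coeff.support := by
      rw [hg, Finsupp.mem_support_iff, monomial, AddMonoidAlgebra.coeff_single_mul_add, one_mul]
      exact Finsupp.mem_support_iff.1 hb
    obtain ⟨c, hc, hcb⟩ := hsupp _ hab
    -- The exponents of the quotient lie in `ℕA ∩ ℤF = ℕF`.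
    refine hF.mem_semigroup_of_mem_lattice b.2 ?_
    have h1 := add_mem (hz c hc) (semigroup_le_lattice hf)
    have h2 := congrArg (Subtype.val : semigroup A → Fin d → ℤ) hcb
    push_cast at h2
    convert h1 using 1
    rw [sub_add_eq_add_sub, ← h2, add_sub_cancel_left]

/-- If `K` and `L` are strictly larger with intersection the coset ideal, they contain some `t^a *
g` and `t^a * h`, so `t^a * (g * h)` lies in both. But `g * h ≠ 0` has exponents in `ℕF`, and every
exponent in `a + ℕF` is standard. -/
theorem infIrred_cosetIdeal (hF : IsFace A F) {a : semigroup A} {n : ℕ}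
    (hn : facePrime k A F ^ n ≤ cosetIdeal k F a) : InfIrred (cosetIdeal k F a) := by
  classical
  refine ⟨fun h => ?_, fun K L hKL => ?_⟩
  · exact monomial_notMem_cosetIdeal (k := k) (F := F) (a := a) (b := a) (by simp)
      (isMax_iff_eq_top.1 h ▸ Submodule.mem_top)
  · by_contra! hne
    have hK : cosetIdeal k F a < K := lt_of_le_of_ne (hKL ▸ inf_le_left) hne.1.symm
    have hL : cosetIdeal k F a < L := lt_of_le_of_ne (hKL ▸ inf_le_right) hne.2.symm
    obtain ⟨g, hg0, hg, hgK⟩ := exists_monomial_mul_mem_of_cosetIdeal_lt hF hn hK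
    obtain ⟨h, hh0, hh, hhL⟩ := exists_monomial_mul_mem_of_cosetIdeal_lt hF hn hL
    have hmem : monomial k a * (g * h) ∈ cosetIdeal k F a := by
      rw [← hKL]
      refine ⟨?_, ?_⟩
      · rw [← mul_assoc]
        exact Ideal.mul_mem_right _ _ hgK
      · rw [mul_left_comm]
        exact Ideal.mul_mem_left _ _ hhL
    obtain ⟨b, hb⟩ : (g * h).coeff.support.Nonempty := by
      rw [Finsupp.support_nonempty_iff, ne_eq, AddMonoidAlgebra.coeff_eq_zero]
      exact mul_ne_zero hg0 hh0
    refine monomial_notMem_cosetIdeal ?_ ((isMonomial_cosetIdeal a).mem_iff.1 hmem (a + b) ?_)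
    · obtain ⟨c, hc, e, he, rfl⟩ :=
        Finset.mem_add.1 (AddMonoidAlgebra.support_coeff_mul_subset _ _ hb)
      simpa using semigroup_le_lattice (add_mem (hg c hc) (hh e he))
    · rw [Finsupp.mem_support_iff, monomial, AddMonoidAlgebra.coeff_single_mul_add, one_mul]
      exact Finsupp.mem_support_iff.1 hb

end Ring

end SemigroupRing

namespace SemigroupRing

/-! ### Standard pairs of a primary monomial ideal. -/

section Pairs

variable {k : Type*} [Field k] {d : ℕ} {A F : Finset (Fin d → ℤ)} {I : Ideal (MonoidRing k A)}

theorem coe_mem_stdMono {a : semigroup A} : (a : Fin d → ℤ) ∈ stdMono I ↔ monomial k a ∉ I := by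
  simp [stdMono]

/-- Translation by `ℕF` preserves standardness, so the socle property depends only on the coset of
`ℤF`. -/
theorem IsSocleExponent.of_sub_mem_lattice (hF : IsFace A F) (hprim : I.IsPrimary)
    (hrad : I.radical = facePrime k A F) {a b : semigroup A} (ha : IsSocleExponent F I a)
    (hb : monomial k b ∉ I) (h : (b : Fin d → ℤ) - a ∈ lattice F) : IsSocleExponent F I b := by
  refine ⟨hb, fun q hq => ha.2 q ?_⟩
  obtain ⟨f, hf, g, hg, h⟩ := exists_sub_eq_of_mem_lattice h
  have h1 : b + q + ⟨g, hF.semigroup_le hg⟩ = a + q + ⟨f, hF.semigroup_le hf⟩ := by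
    ext1
    push_cast
    rw [sub_eq_sub_iff_add_eq_add] at h
    rw [add_right_comm, h]
    abel
  have h2 := hF.monomial_add_notMem hprim hrad hq (f := ⟨g, hF.semigroup_le hg⟩) hg
  rw [h1] at h2
  exact monomial_notMem_of_add h2

namespace FacePair

/-- The base of a pair, as an element of `ℕA`. -/
def point (P : FacePair A) : semigroup A := ⟨P.base, P.base_mem⟩

theorem ext_of_eq {P Q : FacePair A} (hb : P.base = Q.base) (hf : P.face = Q.face) : P = Q := by
  cases P
  cases Q
  cases hb
  cases hf
  rfl

theorem add_mem_region (P : FacePair A) {f : Fin d → ℤ} (hf : f ∈ semigroup P.face) :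
    P.base + f ∈ P.region := ⟨f, hf, rfl⟩

theorem base_mem_region (P : FacePair A) : P.base ∈ P.region := ⟨0, zero_mem _, by simp⟩

theorem IsProper.monomial_notMem {P : FacePair A} (hP : P.IsProper I) : monomial k P.point ∉ I :=
  coe_mem_stdMono.1 (hP P.base_mem_region)

/-- For a generator `g` of the face outside `F`, a power of `t^g` lies in `I`, yet all translates of
the base by multiples of `g` must be standard. -/
theorem IsProper.face_subset (hF : IsFace A F) (hrad : I.radical = facePrime k A F)
    {P : FacePair A} (hP : P.IsProper I) : P.face ⊆ F := by
  intro g hg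
  by_contra hgF
  have hgA : g ∈ semigroup A := AddSubmonoid.subset_closure (P.isFace.subset hg)
  have h1 : monomial k ⟨g, hgA⟩ ∈ facePrime k A F :=
    hF.monomial_mem_facePrime.2 fun h =>
      hgF (hF.mem_of_mem_cone g (P.isFace.subset hg) (toReal_mem_cone h))
  rw [← hrad] at h1
  obtain ⟨n, hn⟩ := h1
  have hpow : monomial k ⟨g, hgA⟩ ^ n = monomial k (n • ⟨g, hgA⟩ : semigroup A) := by
    simp [monomial, AddMonoidAlgebra.single_pow]
  rw [hpow] at hn
  have h2 : ((P.point + n • ⟨g, hgA⟩ : semigroup A) : Fin d → ℤ) ∈ stdMono I :=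
    hP ⟨n • g, nsmul_mem (AddSubmonoid.subset_closure hg) n, by simp [point]⟩
  rw [coe_mem_stdMono, monomial_add] at h2
  exact h2 (Ideal.mul_mem_left _ _ hn)

theorem isProper_of_face_eq (hF : IsFace A F) (hprim : I.IsPrimary)
    (hrad : I.radical = facePrime k A F) {P : FacePair A} (hP : monomial k P.point ∉ I)
    (hPF : P.face = F) : P.IsProper I := by
  rintro _ ⟨f, hf, rfl⟩
  rw [hPF] at hf
  exact coe_mem_stdMono.2
    (hF.monomial_add_notMem hprim hrad hP (f := ⟨f, hF.semigroup_le hf⟩) hf)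

/-- Enlarging the face to `F` keeps the pair proper, so maximality leaves no room. -/
theorem IsStandard.face_eq (hF : IsFace A F) (hprim : I.IsPrimary)
    (hrad : I.radical = facePrime k A F) {P : FacePair A} (hP : P.IsStandard I) : P.face = F := by
  have h := hP.2 ⟨P.base, P.base_mem, F, hF⟩
    (isProper_of_face_eq hF hprim hrad hP.1.monomial_notMem rfl) ?_
  · rw [← h]
  · rintro _ ⟨f, hf, rfl⟩
    exact ⟨f, AddSubmonoid.closure_mono
      (by exact_mod_cast hP.1.face_subset hF hrad) hf, rfl⟩

theorem exists_isStandard (hA : StronglyConvex A) (hF : IsFace A F) (hprim : I.IsPrimary)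
    (hrad : I.radical = facePrime k A F) {a : semigroup A} (ha : monomial k a ∉ I) :
    ∃ P : FacePair A, P.IsStandard I ∧ ∃ f ∈ semigroup F, (a : Fin d → ℤ) = P.base + f := by
  -- Among all `b` with `a ∈ b + ℕF`, choose one whose principal ideal `⟨t^b⟩` is maximal; this base
  -- cannot be moved further back along `F`.
  obtain ⟨_, ⟨b, ⟨f, hf, hab⟩, rfl⟩, hmax⟩ := set_has_maximal_iff_noetherian.2
    (inferInstance : IsNoetherian (MonoidRing k A) (MonoidRing k A))
    ((fun b => Ideal.span (monomial k '' {b})) ''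
      {b : semigroup A | ∃ f ∈ semigroup F, (a : Fin d → ℤ) = b + f})
    ⟨_, a, ⟨0, zero_mem _, by simp⟩, rfl⟩
  have hb : monomial k b ∉ I := by
    have : a = b + ⟨f, hF.semigroup_le hf⟩ := Subtype.ext hab
    exact monomial_notMem_of_add (this ▸ ha)
  refine ⟨⟨b, b.2, F, hF⟩, ⟨isProper_of_face_eq hF hprim hrad hb rfl, fun Q hQ hPQ => ?_⟩,
    f, hf, hab⟩
  have hQF := hQ.face_subset hF hrad
  obtain ⟨g, hg, hbg⟩ := hPQ (base_mem_region _)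
  have hgF : g ∈ semigroup F := AddSubmonoid.closure_mono (by exact_mod_cast hQF) hg
  have hgA := hF.semigroup_le hgF
  have hbg' : b = Q.point + ⟨g, hgA⟩ := Subtype.ext hbg
  -- Maximality makes `g` invertible in `ℕA`, and strong convexity leaves only zero.
  have hg0 : g = 0 := by
    have hle : Ideal.span (monomial k '' {b}) ≤ Ideal.span (monomial k '' {Q.point}) := by
      rw [Ideal.span_le, Set.image_singleton, Set.singleton_subset_iff]
      exact monomial_mem_span.2 ⟨_, rfl, ⟨g, hgA⟩, by rw [add_comm, hbg']⟩
    have hmem : monomial k Q.point ∈ Ideal.span (monomial k '' {b}) := by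
      rw [hle.eq_of_not_lt (hmax _ ⟨Q.point, ⟨g + f, add_mem hgF hf, ?_⟩, rfl⟩)]
      · exact Ideal.subset_span ⟨_, rfl, rfl⟩
      · rw [hab, hbg', ← add_assoc]
        rfl
    obtain ⟨_, rfl, c, hc⟩ := monomial_mem_span.1 hmem
    refine hA.eq_zero_of_add_eq_zero hgA c.2 ?_
    have h1 := congrArg (Subtype.val : semigroup A → Fin d → ℤ) hc
    rw [hbg'] at h1
    push_cast at h1
    rw [add_left_comm, left_eq_add] at h1
    rw [add_comm, h1]
  subst hg0
  have hbQ : Q.base = b := by simpa using hbg.symm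
  refine ext_of_eq hbQ (Finset.Subset.antisymm hQF (Q.isFace.subset_of_semigroup_le hF ?_))
  intro f hf
  obtain ⟨e, he, hfe⟩ := hPQ (add_mem_region _ hf)
  rw [hbQ] at hfe
  exact add_left_cancel hfe ▸ he

end FacePair

/-! ### Maximal overlap classes as socle classes. -/

namespace OverlapClass

/-- The base of a chosen standard pair in an overlap class. -/
noncomputable def point (C : OverlapClass I) : semigroup A := C.out.1.point

theorem monomial_point_notMem (C : OverlapClass I) : monomial k C.point ∉ I :=
  C.out.2.1.monomial_notMem

theorem eq_mk_iff (hF : IsFace A F) (hprim : I.IsPrimary)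
    (hrad : I.radical = facePrime k A F) {C : OverlapClass I} {P : StdPairs I} :
    C = Quotient.mk _ P ↔ (C.point : Fin d → ℤ) - P.1.base ∈ lattice F := by
  rw [← Quotient.out_eq C, Quotient.eq, Quotient.out_eq]
  change (C.out.1.face = P.1.face ∧ _) ↔ _
  rw [C.out.2.face_eq hF hprim hrad, P.2.face_eq hF hprim hrad]
  exact and_iff_right rfl

theorem eq_iff (hF : IsFace A F) (hprim : I.IsPrimary)
    (hrad : I.radical = facePrime k A F) {C D : OverlapClass I} :
    C = D ↔ (C.point : Fin d → ℤ) - D.point ∈ lattice F := by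
  conv_lhs => rw [← Quotient.out_eq D]
  exact eq_mk_iff hF hprim hrad

/-- A standard translate of `C.point` lies in a standard pair whose class `C` divides, so for
maximal `C` the translation is in `ℤF ∩ ℕA = ℕF`. Conversely, divisibility out of a socle class is
by some `c ∈ ℕF`, which stays in the class. -/
theorem mem_maximalClasses_iff (hA : StronglyConvex A) (hF : IsFace A F) (hmon : IsMonomial I)
    (hprim : I.IsPrimary) (hrad : I.radical = facePrime k A F) {n : ℕ}
    (hn : facePrime k A F ^ n ≤ I) {C : OverlapClass I} :
    C ∈ maximalClasses I ↔ IsSocleExponent F I C.point := by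
  constructor
  · refine fun hC => ⟨C.monomial_point_notMem, fun q hq => ?_⟩
    obtain ⟨r, hr⟩ := hmon.exists_add_isSocleExponent hn hq
    obtain ⟨P, hP, f, hf, hPf⟩ := FacePair.exists_isStandard hA hF hprim hrad hr.1
    have hD := hC (Quotient.mk _ ⟨P, hP⟩) ⟨C.out, ⟨P, hP⟩, Quotient.out_eq C, rfl, (q + r : _),
      (q + r).2, fun e he => ⟨f + e, ?_, ?_⟩⟩
    · have h1 := (eq_mk_iff hF hprim hrad).1 hD.symm
      have h2 := sub_mem (semigroup_le_lattice hf) h1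
      have h3 : f - ((C.point : Fin d → ℤ) - P.base) = ((q + r : semigroup A) : Fin d → ℤ) := by
        push_cast at hPf ⊢
        rw [sub_sub_eq_add_sub, add_comm f, ← hPf]
        abel
      rw [h3] at h2
      exact hF.mem_of_add_mem q.2 r.2 (hF.mem_semigroup_of_mem_lattice (q + r).2 h2)
    · rw [C.out.2.face_eq hF hprim hrad] at he
      rw [hP.face_eq hF hprim hrad]
      exact add_mem hf he
    · change (C.point : Fin d → ℤ) + _ + e = P.base + (f + e)
      rw [← add_assoc, ← hPf]
      push_cast
      abel
  · rintro hC D ⟨P, Q, rfl, rfl, c, hc, h⟩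
    have hP : IsSocleExponent F I P.1.point := by
      refine hC.of_sub_mem_lattice hF hprim hrad P.2.1.monomial_notMem ?_
      rw [← neg_sub]
      exact neg_mem ((eq_mk_iff hF hprim hrad).1 rfl)
    obtain ⟨f, hf, hPc⟩ := h 0 (zero_mem _)
    rw [add_zero] at hPc
    have hcF : c ∈ semigroup F := by
      refine hP.2 ⟨c, hc⟩ (coe_mem_stdMono.1 (Q.2.1 ?_))
      exact ⟨f, hf, hPc⟩
    rw [Q.2.face_eq hF hprim hrad] at hf
    refine Quotient.sound ⟨?_, ?_⟩
    · rw [Q.2.face_eq hF hprim hrad, P.2.face_eq hF hprim hrad]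
    · rw [Q.2.face_eq hF hprim hrad]
      have h1 := sub_mem (semigroup_le_lattice hcF) (semigroup_le_lattice hf)
      convert h1 using 1
      rw [sub_eq_sub_iff_add_eq_add, ← hPc, add_comm]

/-- Some `C.point + q` lies in the coset of `D.point`; it is standard for `I` as well, so `q ∈ ℕF`.
This yields both irredundancy and distinctness of the components. -/
theorem eq_of_monomial_notMem_cosetIdeal (hF : IsFace A F) (hmon : IsMonomial I)
    (hprim : I.IsPrimary) (hrad : I.radical = facePrime k A F) {C D : OverlapClass I}
    (hC : IsSocleExponent F I C.point) (h : monomial k C.point ∉ cosetIdeal k F D.point) :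
    C = D := by
  rw [monomial_mem_cosetIdeal] at h
  push Not at h
  obtain ⟨q, hq⟩ := h
  have h1 := hC.2 q fun hI => monomial_notMem_cosetIdeal hq
    (le_cosetIdeal hF hmon hprim hrad D.monomial_point_notMem hI)
  rw [eq_iff hF hprim hrad]
  convert sub_mem hq (semigroup_le_lattice h1) using 1
  push_cast
  abel

end OverlapClass

/-- The ideal spanned by the points of maximal classes is generated by finitely many of them. Each
point is then `D.point + c` with `D.point` among these; the socle property gives `c ∈ ℕF`, so no new
class arises. -/
theorem finite_maximalClasses (hA : StronglyConvex A) (hF : IsFace A F) (hmon : IsMonomial I)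
    (hprim : I.IsPrimary) (hrad : I.radical = facePrime k A F) {n : ℕ}
    (hn : facePrime k A F ^ n ≤ I) : (maximalClasses I).Finite := by
  obtain ⟨s, hs, hspan⟩ := (Submodule.fg_span_iff_fg_span_finset_subset _).1
    (IsNoetherian.noetherian
      (Ideal.span (monomial k '' (OverlapClass.point '' maximalClasses I))))
  refine Set.Finite.of_finite_image (f := OverlapClass.point) (Set.Finite.of_finite_image
    (f := monomial k) (s.finite_toSet.subset ?_) ?_) ?_
  · rintro _ ⟨_, ⟨C, hC, rfl⟩, rfl⟩
    have hCs : monomial k C.point ∈ Ideal.span (s : Set (MonoidRing k A)) := by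
      rw [Ideal.span, ← hspan]
      exact Ideal.subset_span ⟨_, ⟨C, hC, rfl⟩, rfl⟩
    obtain ⟨T, hT, hTs⟩ := Set.subset_image_iff.1 hs
    rw [← hTs] at hCs ⊢
    obtain ⟨_, hD, c, hc⟩ := monomial_mem_span.1 hCs
    obtain ⟨D, hDM, rfl⟩ := hT hD
    have hDs := (OverlapClass.mem_maximalClasses_iff hA hF hmon hprim hrad hn).1 hDM
    have hcF := hDs.2 c (by rw [add_comm, ← hc]; exact C.monomial_point_notMem)
    have : C = D := by
      rw [OverlapClass.eq_iff hF hprim hrad, hc]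
      simpa using semigroup_le_lattice hcF
    exact ⟨_, this ▸ hD, rfl⟩
  · intro a _ b _ h
    rw [← Finset.singleton_inj, ← support_monomial (k := k), h, support_monomial]
  · exact fun C _ D _ h => (OverlapClass.eq_iff hF hprim hrad).2 (by simp [h])

/-! ### The canonical decomposition and the count. -/

/-- The decomposition of a monomial primary ideal indexed by its maximal overlap classes. -/
theorem exists_decomposition_card_eq (hA : StronglyConvex A) (hF : IsFace A F)
    (hmon : IsMonomial I) (hprim : I.IsPrimary) (hrad : I.radical = facePrime k A F) :
    ∃ t : Finset (Ideal (MonoidRing k A)), IsIrredundantIrreducibleDecomposition I t ∧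
      (maximalClasses I).encard = (t.card : ℕ∞) := by
  classical
  obtain ⟨n, hn⟩ := I.exists_radical_pow_le_of_fg (IsNoetherian.noetherian _)
  rw [hrad] at hn
  have hsocle {C : OverlapClass I} :=
    OverlapClass.mem_maximalClasses_iff hA hF hmon hprim hrad hn (C := C)
  have hfin := finite_maximalClasses hA hF hmon hprim hrad hn
  have hle (C : OverlapClass I) : I ≤ cosetIdeal k F C.point :=
    le_cosetIdeal hF hmon hprim hrad C.monomial_point_notMem
  refine ⟨hfin.toFinset.image fun C => cosetIdeal k F C.point, ⟨?_, ?_, ?_⟩, ?_⟩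
  · intro J hJ
    obtain ⟨C, -, rfl⟩ := Finset.mem_image.1 hJ
    exact infIrred_cosetIdeal hF (hn.trans (hle C))
  · refine le_antisymm (fun x hx => ?_) (Finset.le_inf fun J hJ => ?_)
    · rw [hmon.mem_iff]
      intro b hb
      by_contra hbI
      -- A standard exponent `b` of `x` translates to a socle exponent `b + q`; the coset ideal of
      -- its class omits `t^b`.
      obtain ⟨q, hq⟩ := hmon.exists_add_isSocleExponent hn hbI
      obtain ⟨P, hP, f, hf, hPf⟩ := FacePair.exists_isStandard hA hF hprim hrad hq.1
      obtain ⟨C, hC⟩ : ∃ C : OverlapClass I, C = Quotient.mk _ ⟨P, hP⟩ := ⟨_, rfl⟩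
      have h1 : ((b + q : semigroup A) : Fin d → ℤ) - C.point ∈ lattice F := by
        have h2 := (OverlapClass.eq_mk_iff hF hprim hrad).1 hC
        convert sub_mem (semigroup_le_lattice hf) h2 using 1
        rw [hPf]
        abel
      have hCM : C ∈ maximalClasses I := by
        refine hsocle.2 (hq.of_sub_mem_lattice hF hprim hrad C.monomial_point_notMem ?_)
        rw [← neg_sub]
        exact neg_mem h1
      have hinf : (hfin.toFinset.image fun C => cosetIdeal k F C.point).inf id ≤
          cosetIdeal k F C.point :=
        Finset.inf_le (f := id) (Finset.mem_image_of_mem _ (hfin.mem_toFinset.2 hCM))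
      exact monomial_mem_cosetIdeal.1 ((isMonomial_cosetIdeal _).mem_iff.1 (hinf hx) b hb) q h1
    · obtain ⟨C, -, rfl⟩ := Finset.mem_image.1 hJ
      exact hle C
  · intro J hJ h
    obtain ⟨C, hC, rfl⟩ := Finset.mem_image.1 hJ
    rw [hfin.mem_toFinset] at hC
    -- The monomial at `C.point` lies in every other component but not in its own.
    refine monomial_notMem_cosetIdeal (k := k) (F := F) (a := C.point) (b := C.point) (by simp)
      (h ?_)
    rw [Submodule.mem_finsetInf]
    intro K hK
    obtain ⟨hne, hK⟩ := Finset.mem_erase.1 hK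
    obtain ⟨D, -, rfl⟩ := Finset.mem_image.1 hK
    by_contra hCD
    exact hne (by
      rw [OverlapClass.eq_of_monomial_notMem_cosetIdeal hF hmon hprim hrad (hsocle.1 hC) hCD])
  · rw [Finset.card_image_of_injOn, hfin.encard_eq_coe_toFinset_card]
    intro C hC D _ hCD
    refine OverlapClass.eq_of_monomial_notMem_cosetIdeal hF hmon hprim hrad
      (hsocle.1 (hfin.mem_toFinset.1 hC)) ?_
    rw [← show cosetIdeal k F C.point = cosetIdeal k F D.point from hCD]
    exact monomial_notMem_cosetIdeal (by simp)

end Pairs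

end SemigroupRing

theorem mainTheorem5 {k : Type*} [Field k] [Infinite k] {d : ℕ} (A : Finset (Fin d → ℤ))
    (hA0 : (0 : Fin d → ℤ) ∉ A) (hA : SemigroupRing.StronglyConvex A)
    (F : Finset (Fin d → ℤ)) (hF : SemigroupRing.IsFace A F)
    (I : Ideal (SemigroupRing.MonoidRing k A)) (hmon : SemigroupRing.IsMonomial I)
    (hprim : I.IsPrimary) (hrad : I.radical = SemigroupRing.facePrime k A F) :
    (∃ t : Finset (Ideal (SemigroupRing.MonoidRing k A)),
      SemigroupRing.IsIrredundantIrreducibleDecomposition I t) ∧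
    (∀ t : Finset (Ideal (SemigroupRing.MonoidRing k A)),
      SemigroupRing.IsIrredundantIrreducibleDecomposition I t →
        (SemigroupRing.maximalClasses I).encard = (t.card : ℕ∞)) ∧
    (InfIrred I ↔ ∃! C : SemigroupRing.OverlapClass I, C ∈ SemigroupRing.maximalClasses I) := by
  obtain ⟨t, ht, hcard⟩ := SemigroupRing.exists_decomposition_card_eq hA hF hmon hprim hrad
  have hall : ∀ s, SemigroupRing.IsIrredundantIrreducibleDecomposition I s →
      (SemigroupRing.maximalClasses I).encard = (s.card : ℕ∞) := fun s hs => by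
    rw [hcard, ht.card_eq hs]
  refine ⟨⟨t, ht⟩, hall, ?_⟩
  have hiff : (∃! C : SemigroupRing.OverlapClass I, C ∈ SemigroupRing.maximalClasses I) ↔
      (SemigroupRing.maximalClasses I).encard = 1 := by
    rw [Set.encard_eq_one]
    simp only [ExistsUnique, Set.eq_singleton_iff_unique_mem]
  rw [hiff]
  constructor
  · intro hI
    -- An irreducible `I` is its own one-component decomposition.
    simpa using hall _ (SemigroupRing.isIrredundantIrreducibleDecomposition_singleton hI)
  · intro h
    rw [hcard] at h
    obtain ⟨J, rfl⟩ := Finset.card_eq_one.1 (by exact_mod_cast h)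
    have hJ := ht.irreducible J (Finset.mem_singleton_self J)
    have hJI : J = I := by simpa using ht.inf_eq
    rwa [← hJI]
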